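/- Let $d \in \mathbb{N}$, $I_d = [0,1]^d$, and let $\sigma_0, \theta_0, \theta, \nu_0 > 0$. Let $\mathcal{K}_{\nu_0}$ be the modified Bessel function of the second kind of order $\nu_0$, and let $K$ and $R$ be the isotropic Matérn kernels $$K(x,y) = \sigma_0^2 (\theta_0 \|x-y\|)^{\nu_0} \mathcal{K}_{\nu_0}(\theta_0 \|x-y\|), \qquad R(x,y) = (\theta \|x-y\|)^{\nu_0} \mathcal{K}_{\nu_0}(\theta \|x-y\|),$$ where $\|\cdot\|$ is the Euclidean norm and $r^{\nu_0}\mathcal{K}_{\nu_0}(r)$ is given its limiting value $2^{\nu_0-1}\Gamma(\nu_0)$ at $r=0$. Let $X$ be a zero-mean Gaussian process on $I_d$ with covariance kernel $K$, let $x_1, x_2, \ldots$ be distinct points in $I_d$, and for $N \geq 1$ let $X_N = (X(x_1), \ldots, X(x_N))^{\mathsf T}$, $R_N = (R(x_i,x_j))_{i,j=1}^N$ and $$\hat\sigma_N^2 = \frac{X_N^{\mathsf T} R_N^{-1} X_N}{N},$$ the maximum likelihood estimator of $\sigma^2$ in the model where the covariance kernel is $\sigma^2 R$. Then, for every $N \geq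 1$, $\hat\sigma_N^2$ is integrable, and $$\sigma_0^2 \Big(\frac{\theta}{\theta_0}\Big)^{d} \leq \mathbb{E}[\hat\sigma_N^2] \leq \sigma_0^2 \Big(\frac{\theta_0}{\theta}\Big)^{2\nu_0} \quad \text{if } \theta_0 \geq \theta,$$ $$\sigma_0^2 \Big(\frac{\theta_0}{\theta}\Big)^{2\nu_0} \leq \mathbb{E}[\hat\sigma_N^2] \leq \sigma_0^2 \Big(\frac{\theta}{\theta_0}\Big)^{d} \quad \text{if } \theta \geq \theta_0.$$ In particular, if $\theta = \theta_0$, then $\mathbb{E}[\hat\sigma_N^2] = \sigma_0^2$, i.e. the estimator is unbiased. -/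

import Mathlib

open MeasureTheory ProbabilityTheory

noncomputable section

namespace MaternScale

/-- The modified Bessel function of the second kind of order `ν` at `z > 0`, through
`𝒦_ν(z) = ∫_0^∞ exp (-z cosh t) cosh (ν t) dt`. -/
def besselK (ν z : ℝ) : ℝ :=
  ∫ t in Set.Ioi (0 : ℝ), Real.exp (-z * Real.cosh t) * Real.cosh (ν * t)

/-- The function `r ↦ r ^ ν * 𝒦_ν(r)` on `[0, ∞)`. At `r = 0`, where `𝒦_ν` has a pole, it takes
its limiting value `2 ^ (ν - 1) * Γ(ν)` (for `ν > 0`), as usual for Matérn kernels. -/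
def maternProfile (ν r : ℝ) : ℝ :=
  if r = 0 then (2 : ℝ) ^ (ν - 1) * Real.Gamma ν else r ^ ν * besselK ν r

/-- The isotropic Matérn kernel on `ℝ^d` with smoothness `ν`, range `θ` and scale `σ`:
`σ² (θ ‖x - y‖)^ν 𝒦_ν(θ ‖x - y‖)`. -/
def maternKernel {d : ℕ} (ν θ σ : ℝ) (x y : EuclideanSpace ℝ (Fin d)) : ℝ :=
  σ ^ 2 * maternProfile ν (θ * ‖x - y‖)

/-- The cube `[0, 1]^d`. -/
def unitCube (d : ℕ) : Set (EuclideanSpace ℝ (Fin d)) :=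
  {x | ∀ i, x i ∈ Set.Icc (0 : ℝ) 1}

/-- `X` is a zero-mean Gaussian process on `T` with covariance kernel `K`. -/
structure IsCenteredGaussianProcess {Ω T : Type*} [MeasurableSpace Ω] (X : T → Ω → ℝ)
    (K : T → T → ℝ) (P : Measure Ω) : Prop where
  isGaussianProcess : IsGaussianProcess X P
  mean_eq_zero : ∀ t, P[X t] = 0
  covariance_eq : ∀ s t, cov[X s, X t; P] = K s t

/-- The `N × N` matrix of the kernel `R` at the first `N` points of the sequence `x`. -/
def kernelMatrix {T : Type*} (R : T → T → ℝ) (x : ℕ → T) (N : ℕ) : Matrix (Fin N) (Fin N) ℝ :=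
  Matrix.of fun i j => R (x i) (x j)

/-- The likelihood of `s` given data `y` under the model `y ∼ N(0, s A)`. -/
def scaleLikelihood {N : ℕ} (A : Matrix (Fin N) (Fin N) ℝ) (y : Fin N → ℝ) (s : ℝ) : ℝ :=
  Real.exp (-(y ⬝ᵥ ((s • A)⁻¹).mulVec y) / 2) / √(((2 * Real.pi) • (s • A)).det)

/-- The maximum likelihood estimate `yᵀ A⁻¹ y / N` of `s` in the model `y ∼ N(0, s A)`. -/
def scaleMLE {N : ℕ} (A : Matrix (Fin N) (Fin N) ℝ) (y : Fin N → ℝ) : ℝ :=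
  (y ⬝ᵥ (A⁻¹).mulVec y) / N

/-- For non-zero data, `scaleMLE` is the unique maximiser of the likelihood on `(0, ∞)`. -/
theorem scaleLikelihood_lt_scaleMLE {N : ℕ} {A : Matrix (Fin N) (Fin N) ℝ} (hA : A.PosDef)
    {y : Fin N → ℝ} (hy : y ≠ 0) :
    0 < scaleMLE A y ∧ ∀ s : ℝ, 0 < s → s ≠ scaleMLE A y →
      scaleLikelihood A y s < scaleLikelihood A y (scaleMLE A y) := by
  have hN : 0 < N := by
    rcases Nat.eq_zero_or_pos N with h | h
    · subst h
      exact absurd (Subsingleton.elim y 0) hy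
    · exact h
  have hN' : (0 : ℝ) < N := by exact_mod_cast hN
  have hQ : 0 < y ⬝ᵥ (A⁻¹).mulVec y := by
    have := hA.inv.dotProduct_mulVec_pos hy
    simpa using this
  have hdet : 0 < A.det := hA.det_pos
  have hform : ∀ s : ℝ, 0 < s → scaleLikelihood A y s =
      Real.exp (-(y ⬝ᵥ (A⁻¹).mulVec y) / s / 2) / √((2 * Real.pi) ^ N * (s ^ N * A.det)) := by
    intro s hs
    have hinv : (s • A)⁻¹ = s⁻¹ • A⁻¹ := by
      have h := Matrix.inv_smul' A (Units.mk0 s hs.ne') hdet.ne'.isUnit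
      simpa [Units.smul_def] using h
    unfold scaleLikelihood
    rw [hinv, Matrix.smul_mulVec, dotProduct_smul, Matrix.det_smul, Matrix.det_smul]
    simp only [Fintype.card_fin, smul_eq_mul]
    congr 3
    field_simp
  set Q := y ⬝ᵥ (A⁻¹).mulVec y with hQdef
  have ha : 0 < scaleMLE A y := div_pos hQ hN'
  refine ⟨ha, fun s hs hne => ?_⟩
  rw [hform s hs, hform _ ha]
  have hQa : Q = N * scaleMLE A y := by
    unfold scaleMLE
    rw [← hQdef]
    field_simp
  set a := scaleMLE A y
  have hpi := Real.pi_pos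
  have key : a ^ N < s ^ N * Real.exp (N * (a / s - 1)) := by
    have h1 : a / s < Real.exp (a / s - 1) := by
      have hx : a / s - 1 ≠ 0 := by
        intro h
        apply hne
        field_simp at h
        linarith
      have := Real.add_one_lt_exp hx
      linarith
    have h2 : (a / s) ^ N < Real.exp (a / s - 1) ^ N :=
      pow_lt_pow_left₀ h1 (by positivity) hN.ne'
    rw [← Real.exp_nat_mul, div_pow, div_lt_iff₀ (by positivity)] at h2
    linarith
  rw [div_lt_div_iff₀ (by positivity) (by positivity)]
  apply lt_of_pow_lt_pow_left₀ 2 (by positivity)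
  rw [mul_pow _ _ 2, mul_pow _ _ 2, Real.sq_sqrt (by positivity), Real.sq_sqrt (by positivity),
    ← Real.exp_nat_mul, ← Real.exp_nat_mul]
  have e1 : ((2 : ℕ) : ℝ) * (-Q / s / 2) = -(N * (a / s)) := by
    rw [hQa]; push_cast; field_simp
  have e2 : ((2 : ℕ) : ℝ) * (-Q / a / 2) = N * (a / s - 1) + -(N * (a / s)) := by
    rw [hQa]; push_cast; field_simp; ring
  rw [e1, e2, Real.exp_add]
  have hc : 0 < Real.exp (-(N * (a / s))) * ((2 * Real.pi) ^ N * A.det) := by positivity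
  nlinarith [mul_lt_mul_of_pos_left key hc]

/-- The maximum likelihood estimator of `σ²`, computed from the values of `X` at the first `N`
points of `x`, in the model in which the covariance kernel of `X` is `σ² R`. -/
def sigmaHatSq {Ω T : Type*} (R : T → T → ℝ) (X : T → Ω → ℝ) (x : ℕ → T) (N : ℕ) (ω : Ω) : ℝ :=
  scaleMLE (kernelMatrix R x N) (fun i => X (x i) ω)

end MaternScale

end

/-! Taking expectations entrywise gives `N * E[σ̂²] = tr(R⁻¹ K)`. If `K - c R` is positive
semidefinite, the Schur product theorem gives `tr(R⁻¹ K) ≥ c N`, and likewise for upper bounds. So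
it suffices to compare Matérn quadratic forms `M_θ` of different ranges: for `a ≤ b`, `(a/b)^d M_a ≤
M_b ≤ (b/a)^(2ν) M_a`.

Both comparisons come from writing the Matérn profile as a Gaussian mixture
(`maternProfile_eq_integral`), so that `M_θ` is `2^(ν-1)` times the integral of `u^(ν-1) e^(-u)
G(u/θ²)`, with `G` the Gaussian form. Upper bound (`maternForm_le_rpow_mul`): rescaling `u` turns
the integral into `θ^(2ν)` times one with weight `e^(-θ² u)`, which decreases in `θ` because `G ≥
0`. Lower bound (`pow_mul_maternForm_le`): by Fourier transform, `(π/s)^(d/2) G(s)` is the integral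
of `e^(-s‖w‖²)` against the squared modulus of an exponential sum, hence decreases in `s`; apply
this at each `u`. -/

namespace MaternScale

/-! ### Gaussian quadratic forms via the Fourier transform -/

section GaussianForm

variable {E : Type*} [NormedAddCommGroup E]

/-- The quadratic form of the Gaussian kernel `exp (-‖x - y‖² / (4 s))` at the points `x i`. -/
noncomputable def gaussianForm {N : ℕ} (x : Fin N → E) (v : Fin N → ℝ) (s : ℝ) : ℝ :=
  ∑ i, ∑ j, v i * v j * Real.exp (-‖x i - x j‖ ^ 2 / (4 * s))

variable [InnerProductSpace ℝ E]

/-- The squared modulus of the exponential sum `∑ i, v i * exp (√-1 ⟪x i, w⟫)`. -/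
noncomputable def expSumSq {N : ℕ} (x : Fin N → E) (v : Fin N → ℝ) (w : E) : ℝ :=
  (∑ i, v i * Real.cos (inner ℝ (x i) w)) ^ 2 + (∑ i, v i * Real.sin (inner ℝ (x i) w)) ^ 2

theorem expSumSq_nonneg {N : ℕ} (x : Fin N → E) (v : Fin N → ℝ) (w : E) : 0 ≤ expSumSq x v w := by
  unfold expSumSq; positivity

theorem continuous_expSumSq {N : ℕ} (x : Fin N → E) (v : Fin N → ℝ) :
    Continuous (expSumSq x v) := by
  unfold expSumSq; fun_prop

theorem expSumSq_eq_sum {N : ℕ} (x : Fin N → E) (v : Fin N → ℝ) (w : E) :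
    expSumSq x v w = ∑ i, ∑ j, v i * v j * Real.cos (inner ℝ (x i - x j) w) := by
  simp only [expSumSq, sq, Finset.sum_mul_sum, ← Finset.sum_add_distrib, inner_sub_left,
    Real.cos_sub]
  refine Finset.sum_congr rfl fun i _ => Finset.sum_congr rfl fun j _ => ?_
  ring

/-- Distinct points give distinct characters `w ↦ exp(i⟪x, w⟫)`, and distinct characters are
linearly independent (Dedekind). -/
theorem exists_expSumSq_ne_zero {N : ℕ} {x : Fin N → E} (hx : Function.Injective x)
    {v : Fin N → ℝ} (hv : v ≠ 0) : ∃ w, expSumSq x v w ≠ 0 := by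
  by_contra! h
  let χ : E → Multiplicative E →* ℂ := fun y =>
    { toFun := fun w => Complex.exp ((inner ℝ y w.toAdd : ℝ) * Complex.I)
      map_one' := by simp
      map_mul' := fun a b => by
        simp [inner_add_right, add_mul, Complex.exp_add] }
  have hχ : Function.Injective χ := by
    intro y z hyz
    have key : ∀ w : E, inner ℝ (y - z) w = 0 := by
      intro w
      -- The derivative of a character at the origin along `w` recovers `⟪u, w⟫`, so equal
      -- characters have equal inner products.
      have hd : ∀ u : E, HasDerivAt
          (fun t : ℝ => Complex.exp ((inner ℝ u (t • w) : ℝ) * Complex.I))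
          ((inner ℝ u w : ℝ) * Complex.I) 0 := by
        intro u
        have h1 : HasDerivAt (fun t : ℝ => ((inner ℝ u (t • w) : ℝ) : ℂ) * Complex.I)
            ((inner ℝ u w : ℝ) * Complex.I) 0 := by
          have h2 : HasDerivAt (fun t : ℝ => (inner ℝ u (t • w) : ℝ)) (inner ℝ u w) 0 := by
            simp only [inner_smul_right]
            simpa using (hasDerivAt_id (0 : ℝ)).mul_const (inner ℝ u w)
          exact h2.ofReal_comp.mul_const _
        simpa using h1.cexp
      have he : (fun t : ℝ => Complex.exp ((inner ℝ y (t • w) : ℝ) * Complex.I)) =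
          fun t : ℝ => Complex.exp ((inner ℝ z (t • w) : ℝ) * Complex.I) := by
        funext t
        exact DFunLike.congr_fun hyz (Multiplicative.ofAdd (t • w))
      have h3 := (hd y).unique (he ▸ hd z)
      have h4 := mul_right_cancel₀ Complex.I_ne_zero h3
      rw [inner_sub_left, sub_eq_zero]
      exact_mod_cast h4
    have := key (y - z)
    rwa [inner_self_eq_zero, sub_eq_zero] at this
  have hli := (linearIndependent_monoidHom (Multiplicative E) ℂ).comp (χ ∘ x) (hχ.comp hx)
  rw [Fintype.linearIndependent_iff] at hli
  apply hv
  funext i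
  have := hli (fun i => (v i : ℂ)) ?_ i
  · simpa using this
  · funext w
    have hw := h w.toAdd
    unfold expSumSq at hw
    have h1 : ∑ i, v i * Real.cos (inner ℝ (x i) w.toAdd) = 0 := by nlinarith
    have h2 : ∑ i, v i * Real.sin (inner ℝ (x i) w.toAdd) = 0 := by nlinarith
    have h3 : ∀ i, (v i : ℂ) * Complex.exp ((inner ℝ (x i) w.toAdd : ℝ) * Complex.I) =
        ((v i * Real.cos (inner ℝ (x i) w.toAdd) : ℝ) : ℂ) +
          ((v i * Real.sin (inner ℝ (x i) w.toAdd) : ℝ) : ℂ) * Complex.I := by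
      intro i
      rw [Complex.exp_mul_I]
      push_cast
      ring
    simp only [Function.comp_apply, Finset.sum_apply, Pi.smul_apply, smul_eq_mul, Pi.zero_apply]
    change ∑ i, (v i : ℂ) * Complex.exp ((inner ℝ (x i) w.toAdd : ℝ) * Complex.I) = 0
    simp only [h3, Finset.sum_add_distrib, ← Finset.sum_mul, ← Complex.ofReal_sum, h1, h2]
    simp

theorem gaussian_mul_expSumSq_eq {N : ℕ} (x : Fin N → E) (v : Fin N → ℝ) (s : ℝ) (w : E) :
    Real.exp (-s * ‖w‖ ^ 2) * expSumSq x v w = ∑ i, ∑ j, v i * v j *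
      (Real.exp (-s * ‖w‖ ^ 2) * Real.cos (inner ℝ (x i - x j) w)) := by
  rw [expSumSq_eq_sum]
  simp only [Finset.mul_sum]
  refine Finset.sum_congr rfl fun i _ => Finset.sum_congr rfl fun j _ => ?_
  ring

theorem re_cexp_gaussian (s : ℝ) (y w : E) :
    (Complex.exp (-(s : ℂ) * (‖w‖ : ℂ) ^ 2 + Complex.I * ((inner ℝ y w : ℝ) : ℂ))).re =
      Real.exp (-s * ‖w‖ ^ 2) * Real.cos (inner ℝ y w) := by
  have : (-(s : ℂ) * (‖w‖ : ℂ) ^ 2 + Complex.I * ((inner ℝ y w : ℝ) : ℂ)) =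
      ((-s * ‖w‖ ^ 2 : ℝ) : ℂ) + ((inner ℝ y w : ℝ) : ℂ) * Complex.I := by push_cast; ring
  rw [this, Complex.exp_add, ← Complex.ofReal_exp, Complex.re_ofReal_mul,
    Complex.exp_ofReal_mul_I_re]

variable [FiniteDimensional ℝ E] [MeasurableSpace E] [BorelSpace E]

theorem integrable_gaussian_mul_cos {s : ℝ} (hs : 0 < s) (y : E) :
    Integrable fun w : E => Real.exp (-s * ‖w‖ ^ 2) * Real.cos (inner ℝ y w) := by
  have h := (GaussianFourier.integrable_cexp_neg_mul_sq_norm_add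
    (b := (s : ℂ)) (by simpa using hs) Complex.I y).re
  exact h.congr (Filter.Eventually.of_forall fun w => re_cexp_gaussian s y w)

theorem integral_gaussian_mul_cos {s : ℝ} (hs : 0 < s) (y : E) :
    ∫ w : E, Real.exp (-s * ‖w‖ ^ 2) * Real.cos (inner ℝ y w) =
      (Real.pi / s) ^ (Module.finrank ℝ E / 2 : ℝ) * Real.exp (-‖y‖ ^ 2 / (4 * s)) := by
  have hi := GaussianFourier.integrable_cexp_neg_mul_sq_norm_add
    (b := (s : ℂ)) (by simpa using hs) Complex.I y
  have h := congrArg Complex.re (GaussianFourier.integral_cexp_neg_mul_sq_norm_add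
    (b := (s : ℂ)) (by simpa using hs) Complex.I y)
  rw [← RCLike.re_eq_complex_re, ← integral_re hi] at h
  have h1 : ((Real.pi : ℂ) / s) ^ (Module.finrank ℝ E / 2 : ℂ) *
      Complex.exp (Complex.I ^ 2 * ‖y‖ ^ 2 / (4 * s)) =
      (((Real.pi / s) ^ (Module.finrank ℝ E / 2 : ℝ) *
        Real.exp (-‖y‖ ^ 2 / (4 * s)) : ℝ) : ℂ) := by
    rw [Complex.I_sq]
    push_cast [Complex.ofReal_cpow (by positivity : 0 ≤ Real.pi / s)]
    ring_nf
  rw [h1, RCLike.re_eq_complex_re, Complex.ofReal_re] at h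
  rw [← h]
  exact integral_congr_ae (Filter.Eventually.of_forall fun w => (re_cexp_gaussian s y w).symm)

theorem integrable_gaussian_mul_expSumSq {N : ℕ} (x : Fin N → E) (v : Fin N → ℝ) {s : ℝ}
    (hs : 0 < s) : Integrable fun w : E => Real.exp (-s * ‖w‖ ^ 2) * expSumSq x v w := by
  simp only [gaussian_mul_expSumSq_eq]
  exact integrable_finsetSum _ fun i _ => integrable_finsetSum _ fun j _ =>
    (integrable_gaussian_mul_cos hs _).const_mul _

theorem integral_gaussian_mul_expSumSq {N : ℕ} (x : Fin N → E) (v : Fin N → ℝ) {s : ℝ}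
    (hs : 0 < s) : ∫ w : E, Real.exp (-s * ‖w‖ ^ 2) * expSumSq x v w =
      (Real.pi / s) ^ (Module.finrank ℝ E / 2 : ℝ) * gaussianForm x v s := by
  simp only [gaussian_mul_expSumSq_eq]
  rw [integral_finsetSum _ fun i _ => integrable_finsetSum _ fun j _ =>
    (integrable_gaussian_mul_cos hs _).const_mul _, gaussianForm, Finset.mul_sum]
  refine Finset.sum_congr rfl fun i _ => ?_
  rw [integral_finsetSum _ fun j _ => (integrable_gaussian_mul_cos hs _).const_mul _,
    Finset.mul_sum]
  refine Finset.sum_congr rfl fun j _ => ?_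
  rw [integral_const_mul, integral_gaussian_mul_cos hs]
  ring

theorem gaussianForm_pos {N : ℕ} {x : Fin N → E} (hx : Function.Injective x) {v : Fin N → ℝ}
    (hv : v ≠ 0) {s : ℝ} (hs : 0 < s) : 0 < gaussianForm x v s := by
  have hpi := Real.pi_pos
  obtain ⟨w, hw⟩ := exists_expSumSq_ne_zero hx hv
  have h := integral_gaussian_mul_expSumSq x v hs
  have hpos : 0 < ∫ w : E, Real.exp (-s * ‖w‖ ^ 2) * expSumSq x v w := by
    have hc : Continuous fun w : E => Real.exp (-s * ‖w‖ ^ 2) * expSumSq x v w := by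
      have := continuous_expSumSq x v
      fun_prop
    refine integral_pos_of_integrable_nonneg_nonzero hc
      (integrable_gaussian_mul_expSumSq x v hs)
      (fun w => mul_nonneg (Real.exp_nonneg _) (expSumSq_nonneg x v w))
      (x := w) (mul_ne_zero (Real.exp_ne_zero _) hw)
  rw [h] at hpos
  exact pos_of_mul_pos_right hpos (by positivity)

theorem gaussianForm_nonneg {N : ℕ} (x : Fin N → E) (v : Fin N → ℝ) {s : ℝ} (hs : 0 < s) :
    0 ≤ gaussianForm x v s := by
  have hpi := Real.pi_pos
  have h : 0 ≤ ∫ w : E, Real.exp (-s * ‖w‖ ^ 2) * expSumSq x v w :=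
    integral_nonneg fun w => mul_nonneg (Real.exp_nonneg _) (expSumSq_nonneg x v w)
  rw [integral_gaussian_mul_expSumSq x v hs] at h
  exact nonneg_of_mul_nonneg_right h (by positivity)

/-- The Fourier integral decreases in the Gaussian parameter; the factor is the ratio of the
normalisations `(π/t)^(d/2)` and `(π/s)^(d/2)`. -/
theorem rpow_div_mul_gaussianForm_le {N : ℕ} (x : Fin N → E) (v : Fin N → ℝ) {s t : ℝ}
    (hs : 0 < s) (hst : s ≤ t) :
    (s / t) ^ (Module.finrank ℝ E / 2 : ℝ) * gaussianForm x v t ≤ gaussianForm x v s := by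
  have hpi := Real.pi_pos
  have ht : 0 < t := hs.trans_le hst
  have h : ∫ w : E, Real.exp (-t * ‖w‖ ^ 2) * expSumSq x v w ≤
      ∫ w : E, Real.exp (-s * ‖w‖ ^ 2) * expSumSq x v w := by
    refine integral_mono (integrable_gaussian_mul_expSumSq x v ht)
      (integrable_gaussian_mul_expSumSq x v hs) fun w => ?_
    refine mul_le_mul_of_nonneg_right (Real.exp_le_exp.2 ?_) (expSumSq_nonneg x v w)
    nlinarith [sq_nonneg ‖w‖]
  rw [integral_gaussian_mul_expSumSq x v ht, integral_gaussian_mul_expSumSq x v hs] at h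
  have he : Real.pi / t = Real.pi / s * (s / t) := by field_simp
  rw [he, Real.mul_rpow (by positivity) (by positivity), mul_assoc] at h
  exact le_of_mul_le_mul_left h (by positivity)

end GaussianForm

/-! ### The Matérn profile as a Gaussian mixture -/

theorem integrableOn_rpow_mul_exp_mul_exp {ν b : ℝ} (hν : 0 < ν) (hb : 0 < b) {a : ℝ}
    (ha : 0 ≤ a) : IntegrableOn
      (fun u => u ^ (ν - 1) * Real.exp (-b * u) * Real.exp (-a / (4 * u))) (Set.Ioi 0) := by
  have h := integrableOn_rpow_mul_exp_neg_mul_rpow (s := ν - 1) (p := 1) (by linarith) one_pos hb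
  simp only [Real.rpow_one] at h
  refine Integrable.mono' h (by fun_prop) ?_
  refine (ae_restrict_mem measurableSet_Ioi).mono fun u hu => ?_
  have hu : 0 < u := hu
  rw [Real.norm_of_nonneg (by positivity)]
  refine mul_le_of_le_one_right (by positivity) (Real.exp_le_one_iff.2 ?_)
  exact div_nonpos_of_nonpos_of_nonneg (by linarith) (by positivity)

theorem integral_comp_exp_smul (g : ℝ → ℝ) :
    ∫ t, Real.exp t * g (Real.exp t) = ∫ u in Set.Ioi 0, g u := by
  have h := integral_image_eq_integral_abs_deriv_smul MeasurableSet.univ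
    (fun t _ => (Real.hasDerivAt_exp t).hasDerivWithinAt) Real.exp_injective.injOn g
  simpa [Real.range_exp, abs_of_pos (Real.exp_pos _)] using h.symm

theorem integrable_comp_exp_smul {g : ℝ → ℝ} (hg : IntegrableOn g (Set.Ioi 0)) :
    Integrable fun t => Real.exp t * g (Real.exp t) := by
  have h := integrableOn_image_iff_integrableOn_abs_deriv_smul MeasurableSet.univ
    (fun t _ => (Real.hasDerivAt_exp t).hasDerivWithinAt) Real.exp_injective.injOn g
  simpa [Real.range_exp, abs_of_pos (Real.exp_pos _), hg] using h

theorem integral_eq_integral_Ioi_add_comp_neg {f : ℝ → ℝ} (hf : Integrable f) :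
    ∫ t, f t = ∫ t in Set.Ioi 0, (f t + f (-t)) := by
  rw [integral_add hf.integrableOn hf.comp_neg.integrableOn, integral_comp_neg_Ioi, neg_zero,
    add_comm, intervalIntegral.integral_Iic_add_Ioi hf.integrableOn hf.integrableOn]

/-- The Matérn profile is a mixture of Gaussians over the scale. -/
theorem maternProfile_eq_integral {ν : ℝ} (hν : 0 < ν) {r : ℝ} (hr : 0 ≤ r) :
    maternProfile ν r = 2 ^ (ν - 1) *
      ∫ u in Set.Ioi 0, u ^ (ν - 1) * Real.exp (-1 * u) * Real.exp (-r ^ 2 / (4 * u)) := by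
  unfold maternProfile
  split_ifs with h0
  · subst h0
    rw [Real.Gamma_eq_integral hν]
    congr 1
    refine setIntegral_congr_fun measurableSet_Ioi fun u _ => ?_
    simp [mul_comm]
  have hr : 0 < r := lt_of_le_of_ne hr (Ne.symm h0)
  set g : ℝ → ℝ := fun u => u ^ (ν - 1) * Real.exp (-1 * u) * Real.exp (-r ^ 2 / (4 * u))
    with hg
  have hgi : IntegrableOn g (Set.Ioi 0) := integrableOn_rpow_mul_exp_mul_exp hν one_pos (sq_nonneg r)
  have hr2 : 0 < r / 2 := by positivity
  have hgi2 : IntegrableOn (fun u => r / 2 * g (r / 2 * u)) (Set.Ioi 0) := by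
    have := (integrableOn_Ioi_comp_mul_left_iff g 0 hr2).2 (by simpa using hgi)
    exact this.const_mul _
  have h1 : ∫ u in Set.Ioi 0, g u = ∫ u in Set.Ioi 0, r / 2 * g (r / 2 * u) := by
    have := integral_comp_mul_left_Ioi' g 0 hr2
    rw [mul_zero] at this
    rw [← this, integral_const_mul, smul_eq_mul]
  -- The substitution `u = (r/2) e^t` balances the exponents: `u + r²/(4u) = r cosh t`.
  have hform : ∀ t : ℝ, Real.exp t * (r / 2 * g (r / 2 * Real.exp t)) =
      (r / 2) ^ ν * (Real.exp (-r * Real.cosh t) * Real.exp (ν * t)) := by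
    intro t
    have hpos : 0 < r / 2 * Real.exp t := by positivity
    have e1 : (r / 2 * Real.exp t) * (r / 2 * Real.exp t) ^ (ν - 1) =
        (r / 2) ^ ν * Real.exp (ν * t) := by
      rw [← Real.rpow_one_add' hpos.le (by simpa using hν.ne'), add_sub_cancel,
        Real.mul_rpow hr2.le (Real.exp_nonneg t), ← Real.exp_mul, mul_comm t]
    have e2 : Real.exp (-1 * (r / 2 * Real.exp t)) *
        Real.exp (-r ^ 2 / (4 * (r / 2 * Real.exp t))) = Real.exp (-r * Real.cosh t) := by
      rw [← Real.exp_add, Real.cosh_eq, Real.exp_neg]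
      congr 1
      have := (Real.exp_pos t).ne'
      field_simp
      ring
    calc Real.exp t * (r / 2 * g (r / 2 * Real.exp t))
        = ((r / 2 * Real.exp t) * (r / 2 * Real.exp t) ^ (ν - 1)) *
          (Real.exp (-1 * (r / 2 * Real.exp t)) *
            Real.exp (-r ^ 2 / (4 * (r / 2 * Real.exp t)))) := by simp only [hg]; ring
      _ = _ := by rw [e1, e2]; ring
  rw [h1, ← integral_comp_exp_smul,
    integral_eq_integral_Ioi_add_comp_neg (integrable_comp_exp_smul hgi2), besselK]
  simp only [hform]
  -- Folding `t` with `-t` turns `exp(ν t)` into `2 cosh(ν t)`, the integrand of `besselK`.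
  have h2 : ∀ t : ℝ, (r / 2) ^ ν * (Real.exp (-r * Real.cosh t) * Real.exp (ν * t)) +
      (r / 2) ^ ν * (Real.exp (-r * Real.cosh (-t)) * Real.exp (ν * -t)) =
      2 * (r / 2) ^ ν * (Real.exp (-r * Real.cosh t) * Real.cosh (ν * t)) := by
    intro t
    rw [Real.cosh_neg, Real.cosh_eq (ν * t), mul_neg]
    ring
  simp only [h2]
  rw [integral_const_mul, ← mul_assoc]
  congr 1
  rw [Real.div_rpow hr.le two_pos.le, Real.rpow_sub_one two_ne_zero]
  have : (2 : ℝ) ^ ν ≠ 0 := by positivity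
  field_simp

/-! ### Comparison of Matérn forms of different ranges -/

section Form

variable {E : Type*} [NormedAddCommGroup E]

/-- The quadratic form of the Matérn kernel with range `θ` at the points `x i`. -/
noncomputable def maternForm {N : ℕ} (ν : ℝ) (x : Fin N → E) (v : Fin N → ℝ) (θ : ℝ) : ℝ :=
  ∑ i, ∑ j, v i * v j * maternProfile ν (θ * ‖x i - x j‖)

theorem rpow_mul_exp_mul_gaussianForm_eq {N : ℕ} (x : Fin N → E) (v : Fin N → ℝ) (ν b c u : ℝ) :
    u ^ (ν - 1) * Real.exp (-b * u) * gaussianForm x v (u / c ^ 2) = ∑ i, ∑ j, v i * v j *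
      (u ^ (ν - 1) * Real.exp (-b * u) * Real.exp (-(c * ‖x i - x j‖) ^ 2 / (4 * u))) := by
  simp only [gaussianForm, Finset.mul_sum]
  refine Finset.sum_congr rfl fun i _ => Finset.sum_congr rfl fun j _ => ?_
  have : -‖x i - x j‖ ^ 2 / (4 * (u / c ^ 2)) = -(c * ‖x i - x j‖) ^ 2 / (4 * u) := by
    rw [← mul_div_assoc, div_div_eq_mul_div]
    ring
  rw [this]
  ring

theorem integrableOn_rpow_mul_exp_mul_gaussianForm {N : ℕ} (x : Fin N → E) (v : Fin N → ℝ)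
    {ν b : ℝ} (hν : 0 < ν) (hb : 0 < b) (c : ℝ) : IntegrableOn
      (fun u => u ^ (ν - 1) * Real.exp (-b * u) * gaussianForm x v (u / c ^ 2)) (Set.Ioi 0) := by
  simp only [rpow_mul_exp_mul_gaussianForm_eq]
  exact integrable_finsetSum _ fun i _ => integrable_finsetSum _ fun j _ =>
    (integrableOn_rpow_mul_exp_mul_exp hν hb (sq_nonneg _)).const_mul _

theorem maternForm_eq_integral {N : ℕ} (x : Fin N → E) (v : Fin N → ℝ) {ν θ : ℝ} (hν : 0 < ν)
    (hθ : 0 < θ) : maternForm ν x v θ = 2 ^ (ν - 1) * ∫ u in Set.Ioi 0,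
      u ^ (ν - 1) * Real.exp (-1 * u) * gaussianForm x v (u / θ ^ 2) := by
  simp only [rpow_mul_exp_mul_gaussianForm_eq]
  have hi : ∀ i j, IntegrableOn (fun u => v i * v j * (u ^ (ν - 1) * Real.exp (-1 * u) *
      Real.exp (-(θ * ‖x i - x j‖) ^ 2 / (4 * u)))) (Set.Ioi 0) := fun i j =>
    (integrableOn_rpow_mul_exp_mul_exp hν one_pos (sq_nonneg _)).const_mul _
  rw [integral_finsetSum _ fun i _ => integrable_finsetSum _ fun j _ => hi i j, maternForm,
    Finset.mul_sum]
  refine Finset.sum_congr rfl fun i _ => ?_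
  rw [integral_finsetSum _ fun j _ => hi i j, Finset.mul_sum]
  refine Finset.sum_congr rfl fun j _ => ?_
  rw [integral_const_mul, maternProfile_eq_integral hν (by positivity)]
  ring

/-- Replacing `u` by `θ² u` moves the range out of the Gaussian form into the exponential weight,
where monotonicity in `θ` is visible. -/
theorem maternForm_eq_rpow_mul_integral {N : ℕ} (x : Fin N → E) (v : Fin N → ℝ) {ν θ : ℝ}
    (hν : 0 < ν) (hθ : 0 < θ) : maternForm ν x v θ = 2 ^ (ν - 1) * (θ ^ (2 * ν) *
      ∫ u in Set.Ioi 0, u ^ (ν - 1) * Real.exp (-θ ^ 2 * u) * gaussianForm x v u) := by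
  rw [maternForm_eq_integral x v hν hθ]
  have hθ2 : 0 < θ ^ 2 := by positivity
  have h := integral_comp_mul_left_Ioi' (fun u : ℝ => u ^ (ν - 1) * Real.exp (-1 * u) *
    gaussianForm x v (u / θ ^ 2)) 0 hθ2
  rw [mul_zero] at h
  rw [← h, smul_eq_mul]
  congr 1
  rw [← integral_const_mul, ← integral_const_mul]
  refine setIntegral_congr_fun measurableSet_Ioi fun u (hu : 0 < u) => ?_
  -- Jacobian `θ²` times the factor pulled out of `u^(ν-1)`.
  have e : θ ^ (2 * ν) = θ ^ 2 * (θ ^ 2) ^ (ν - 1) := by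
    rw [← Real.rpow_one_add' hθ2.le (by simpa using hν.ne'), add_sub_cancel, ← Real.rpow_natCast,
      ← Real.rpow_mul hθ.le]
    norm_num
  simp only [mul_div_cancel_left₀ u hθ2.ne', Real.mul_rpow hθ2.le hu.le, e]
  ring_nf

variable [InnerProductSpace ℝ E] [FiniteDimensional ℝ E] [MeasurableSpace E] [BorelSpace E]

theorem maternForm_pos {N : ℕ} {x : Fin N → E} (hx : Function.Injective x) {v : Fin N → ℝ}
    (hv : v ≠ 0) {ν θ : ℝ} (hν : 0 < ν) (hθ : 0 < θ) : 0 < maternForm ν x v θ := by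
  rw [maternForm_eq_integral x v hν hθ]
  refine mul_pos (by positivity) ?_
  have hpos : ∀ u ∈ Set.Ioi (0 : ℝ),
      0 < u ^ (ν - 1) * Real.exp (-1 * u) * gaussianForm x v (u / θ ^ 2) := by
    intro u hu
    have hu : 0 < u := hu
    have := gaussianForm_pos hx hv (s := u / θ ^ 2) (by positivity)
    positivity
  rw [setIntegral_pos_iff_support_of_nonneg_ae
    ((ae_restrict_mem measurableSet_Ioi).mono fun u hu => (hpos u hu).le)
    (integrableOn_rpow_mul_exp_mul_gaussianForm x v hν one_pos θ)]
  have : Set.Ioi (0 : ℝ) ⊆ Function.support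
      fun u => u ^ (ν - 1) * Real.exp (-1 * u) * gaussianForm x v (u / θ ^ 2) :=
    fun u hu => (hpos u hu).ne'
  rw [Set.inter_eq_right.2 this]
  simp

theorem maternForm_le_rpow_mul {N : ℕ} (x : Fin N → E) (v : Fin N → ℝ) {ν a b : ℝ}
    (hν : 0 < ν) (ha : 0 < a) (hab : a ≤ b) :
    maternForm ν x v b ≤ (b / a) ^ (2 * ν) * maternForm ν x v a := by
  have hb : 0 < b := ha.trans_le hab
  rw [maternForm_eq_rpow_mul_integral x v hν ha, maternForm_eq_rpow_mul_integral x v hν hb,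
    Real.div_rpow hb.le ha.le]
  have hint : ∀ c : ℝ, 0 < c → IntegrableOn
      (fun u => u ^ (ν - 1) * Real.exp (-c ^ 2 * u) * gaussianForm x v u) (Set.Ioi 0) := by
    intro c hc
    simpa using integrableOn_rpow_mul_exp_mul_gaussianForm x v hν (b := c ^ 2) (by positivity) 1
  have h : ∫ u in Set.Ioi 0, u ^ (ν - 1) * Real.exp (-b ^ 2 * u) * gaussianForm x v u ≤
      ∫ u in Set.Ioi 0, u ^ (ν - 1) * Real.exp (-a ^ 2 * u) * gaussianForm x v u := by
    refine setIntegral_mono_on (hint b hb) (hint a ha) measurableSet_Ioi fun u hu => ?_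
    have hu : 0 < u := hu
    refine mul_le_mul_of_nonneg_right (mul_le_mul_of_nonneg_left (Real.exp_le_exp.2 ?_)
      (by positivity)) (gaussianForm_nonneg x v hu)
    have : a ^ 2 ≤ b ^ 2 := pow_le_pow_left₀ ha.le hab 2
    nlinarith
  have hapos : a ^ (2 * ν) ≠ 0 := by positivity
  calc _ ≤ 2 ^ (ν - 1) * (b ^ (2 * ν) *
        ∫ u in Set.Ioi 0, u ^ (ν - 1) * Real.exp (-a ^ 2 * u) * gaussianForm x v u) := by gcongr
    _ = _ := by field_simp

theorem pow_mul_maternForm_le {N : ℕ} (x : Fin N → E) (v : Fin N → ℝ) {ν a b : ℝ}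
    (hν : 0 < ν) (ha : 0 < a) (hab : a ≤ b) :
    (a / b) ^ Module.finrank ℝ E * maternForm ν x v a ≤ maternForm ν x v b := by
  have hb : 0 < b := ha.trans_le hab
  rw [maternForm_eq_integral x v hν ha, maternForm_eq_integral x v hν hb, mul_left_comm,
    ← integral_const_mul]
  refine mul_le_mul_of_nonneg_left ?_ (by positivity)
  refine setIntegral_mono_on
    ((integrableOn_rpow_mul_exp_mul_gaussianForm x v hν one_pos a).const_mul _)
    (integrableOn_rpow_mul_exp_mul_gaussianForm x v hν one_pos b) measurableSet_Ioi fun u hu => ?_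
  have hu : 0 < u := hu
  have hle : u / b ^ 2 ≤ u / a ^ 2 := by gcongr
  -- The ratio of the two scales is `(a/b)²`, whose power `d/2` is `(a/b)^d`.
  have h := rpow_div_mul_gaussianForm_le x v (by positivity : 0 < u / b ^ 2) hle
  have e : (u / b ^ 2 / (u / a ^ 2)) ^ (Module.finrank ℝ E / 2 : ℝ) =
      (a / b) ^ Module.finrank ℝ E := by
    have : u / b ^ 2 / (u / a ^ 2) = (a / b) ^ (2 : ℝ) := by
      rw [Real.rpow_two]
      field_simp
    rw [this, ← Real.rpow_mul (by positivity), mul_div_cancel₀ _ two_ne_zero, Real.rpow_natCast]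
  rw [e] at h
  rw [mul_left_comm]
  exact mul_le_mul_of_nonneg_left h (by positivity)

end Form

/-! ### From Loewner order to trace bounds -/

/-- Schur product theorem, tested on the all-ones vector. -/
theorem sum_mul_nonneg_of_posSemidef {ι : Type*} [Fintype ι] {A B : Matrix ι ι ℝ}
    (hA : A.PosSemidef) (hB : B.PosSemidef) : 0 ≤ ∑ i, ∑ j, A i j * B i j := by
  simpa [dotProduct, Matrix.mulVec, Matrix.hadamard] using
    (hA.hadamard hB).dotProduct_mulVec_nonneg 1

theorem sum_inv_mul_self {ι : Type*} [Fintype ι] [DecidableEq ι] {A : Matrix ι ι ℝ}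
    (hA : A.PosDef) : ∑ i, ∑ j, A⁻¹ i j * A i j = Fintype.card ι := by
  have hsymm : ∀ i j, A i j = A j i := fun i j => by simpa using (hA.isHermitian.apply i j).symm
  have h := congrArg Matrix.trace (Matrix.nonsing_inv_mul A hA.det_pos.ne'.isUnit)
  rw [Matrix.trace_one, Matrix.trace] at h
  rw [← h]
  refine Finset.sum_congr rfl fun i _ => ?_
  rw [Matrix.diag_apply, Matrix.mul_apply]
  exact Finset.sum_congr rfl fun j _ => by rw [hsymm i j]

/-- Pair `A⁻¹` with `B - c A`; the `A` part contributes `c tr(A⁻¹ A)`. -/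
theorem mul_card_le_sum_inv_mul {ι : Type*} [Fintype ι] [DecidableEq ι] {A B : Matrix ι ι ℝ}
    (hA : A.PosDef) {c : ℝ} (h : (B - c • A).PosSemidef) :
    c * Fintype.card ι ≤ ∑ i, ∑ j, A⁻¹ i j * B i j := by
  have h1 := sum_mul_nonneg_of_posSemidef hA.inv.posSemidef h
  rw [← sum_inv_mul_self hA, Finset.mul_sum, ← sub_nonneg, ← Finset.sum_sub_distrib]
  refine h1.trans_eq (Finset.sum_congr rfl fun i _ => ?_)
  rw [Finset.mul_sum, ← Finset.sum_sub_distrib]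
  refine Finset.sum_congr rfl fun j _ => ?_
  simp only [Matrix.sub_apply, Matrix.smul_apply, smul_eq_mul]
  ring

theorem sum_inv_mul_le_mul_card {ι : Type*} [Fintype ι] [DecidableEq ι] {A B : Matrix ι ι ℝ}
    (hA : A.PosDef) {c : ℝ} (h : (c • A - B).PosSemidef) :
    ∑ i, ∑ j, A⁻¹ i j * B i j ≤ c * Fintype.card ι := by
  have h1 := mul_card_le_sum_inv_mul hA (c := -c) (B := -B) (by
    rwa [neg_smul, sub_neg_eq_add, add_comm, ← sub_eq_add_neg])
  simp only [Matrix.neg_apply, mul_neg, Finset.sum_neg_distrib, neg_mul] at h1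
  linarith

/-! ### Expectation of the estimator and the resulting bounds -/

theorem IsCenteredGaussianProcess.integrable_mul {Ω T : Type*} [MeasurableSpace Ω]
    {X : T → Ω → ℝ} {K : T → T → ℝ} {P : Measure Ω}
    (hX : IsCenteredGaussianProcess X K P) (s t : T) :
    Integrable (fun ω => X s ω * X t ω) P :=
  (hX.isGaussianProcess.hasGaussianLaw_eval s).memLp_two.integrable_mul
    (hX.isGaussianProcess.hasGaussianLaw_eval t).memLp_two

theorem IsCenteredGaussianProcess.integral_mul {Ω T : Type*} [MeasurableSpace Ω]
    {X : T → Ω → ℝ} {K : T → T → ℝ} {P : Measure Ω} [IsProbabilityMeasure P]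
    (hX : IsCenteredGaussianProcess X K P) (s t : T) : ∫ ω, X s ω * X t ω ∂P = K s t := by
  have h := covariance_eq_sub (hX.isGaussianProcess.hasGaussianLaw_eval s).memLp_two
    (hX.isGaussianProcess.hasGaussianLaw_eval t).memLp_two
  rw [hX.covariance_eq, hX.mean_eq_zero, zero_mul, sub_zero] at h
  exact h.symm

theorem sigmaHatSq_eq_sum {Ω T : Type*} (R : T → T → ℝ) (X : T → Ω → ℝ) (x : ℕ → T) (N : ℕ)
    (ω : Ω) : sigmaHatSq R X x N ω =
      (∑ i, ∑ j, (kernelMatrix R x N)⁻¹ i j * (X (x i) ω * X (x j) ω)) / N := by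
  simp only [sigmaHatSq, scaleMLE, dotProduct, Matrix.mulVec, Finset.mul_sum]
  congr 1
  refine Finset.sum_congr rfl fun i _ => Finset.sum_congr rfl fun j _ => ?_
  ring

theorem integrable_sigmaHatSq {Ω T : Type*} [MeasurableSpace Ω] {X : T → Ω → ℝ}
    {K : T → T → ℝ} {P : Measure Ω} (hX : IsCenteredGaussianProcess X K P) (R : T → T → ℝ)
    (x : ℕ → T) (N : ℕ) : Integrable (sigmaHatSq R X x N) P := by
  simp only [funext (sigmaHatSq_eq_sum R X x N)]
  exact (integrable_finsetSum _ fun i _ => integrable_finsetSum _ fun j _ =>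
    (hX.integrable_mul _ _).const_mul _).div_const _

theorem integral_sigmaHatSq {Ω T : Type*} [MeasurableSpace Ω] {X : T → Ω → ℝ}
    {K : T → T → ℝ} {P : Measure Ω} [IsProbabilityMeasure P]
    (hX : IsCenteredGaussianProcess X K P) (R : T → T → ℝ) (x : ℕ → T) (N : ℕ) :
    ∫ ω, sigmaHatSq R X x N ω ∂P =
      (∑ i, ∑ j, (kernelMatrix R x N)⁻¹ i j * kernelMatrix K x N i j) / N := by
  have hi : ∀ i j : Fin N, Integrable
      (fun ω => (kernelMatrix R x N)⁻¹ i j * (X (x i) ω * X (x j) ω)) P :=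
    fun i j => (hX.integrable_mul _ _).const_mul _
  simp only [sigmaHatSq_eq_sum]
  rw [integral_div, integral_finsetSum _ fun i _ => integrable_finsetSum _ fun j _ => hi i j]
  congr 1
  refine Finset.sum_congr rfl fun i _ => ?_
  rw [integral_finsetSum _ fun j _ => hi i j]
  refine Finset.sum_congr rfl fun j _ => ?_
  rw [integral_const_mul, hX.integral_mul]
  rfl

theorem dotProduct_kernelMatrix_mulVec {d : ℕ} {ν θ σ : ℝ} {T : Set (EuclideanSpace ℝ (Fin d))}
    {K : T → T → ℝ} (hK : ∀ s t, K s t = maternKernel ν θ σ (s : EuclideanSpace ℝ (Fin d)) t)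
    (x : ℕ → T) (N : ℕ) (v : Fin N → ℝ) :
    v ⬝ᵥ (kernelMatrix K x N).mulVec v =
      σ ^ 2 * maternForm ν (fun i : Fin N => (x i : EuclideanSpace ℝ (Fin d))) v θ := by
  simp only [dotProduct, Matrix.mulVec, kernelMatrix, Matrix.of_apply, hK, maternKernel,
    maternForm, Finset.mul_sum]
  refine Finset.sum_congr rfl fun i _ => Finset.sum_congr rfl fun j _ => ?_
  ring

theorem isHermitian_kernelMatrix {d : ℕ} {ν θ σ : ℝ} {T : Set (EuclideanSpace ℝ (Fin d))}
    {K : T → T → ℝ} (hK : ∀ s t, K s t = maternKernel ν θ σ (s : EuclideanSpace ℝ (Fin d)) t)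
    (x : ℕ → T) (N : ℕ) : (kernelMatrix K x N).IsHermitian := by
  ext i j
  simp [kernelMatrix, hK, maternKernel, norm_sub_rev]

theorem posDef_kernelMatrix {d : ℕ} {ν θ σ : ℝ} (hν : 0 < ν) (hθ : 0 < θ) (hσ : 0 < σ)
    {T : Set (EuclideanSpace ℝ (Fin d))} {K : T → T → ℝ}
    (hK : ∀ s t, K s t = maternKernel ν θ σ (s : EuclideanSpace ℝ (Fin d)) t)
    {x : ℕ → T} (hx : Function.Injective x) (N : ℕ) : (kernelMatrix K x N).PosDef := by
  refine .of_dotProduct_mulVec_pos (isHermitian_kernelMatrix hK x N) fun v hv => ?_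
  rw [star_trivial, dotProduct_kernelMatrix_mulVec hK]
  have hinj : Function.Injective fun i : Fin N => (x i : EuclideanSpace ℝ (Fin d)) :=
    Subtype.val_injective.comp (hx.comp Fin.val_injective)
  have := maternForm_pos hinj hv hν hθ
  positivity

/-- With a scalar on each side, one statement serves both the lower bound (`a = 1`) and the upper
bound (`b = 1`). -/
theorem posSemidef_sub_smul {ι : Type*} [Fintype ι] {A B : Matrix ι ι ℝ} (hA : A.IsHermitian)
    (hB : B.IsHermitian) {a b : ℝ}
    (h : ∀ v, b * (v ⬝ᵥ B.mulVec v) ≤ a * (v ⬝ᵥ A.mulVec v)) : (a • A - b • B).PosSemidef := by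
  refine .of_dotProduct_mulVec_nonneg
    ((hA.smul (.all a)).sub (hB.smul (.all b))) fun v => ?_
  rw [star_trivial, Matrix.sub_mulVec, dotProduct_sub, Matrix.smul_mulVec, Matrix.smul_mulVec,
    dotProduct_smul, dotProduct_smul]
  exact sub_nonneg.2 (h v)

section Bounds

variable {d : ℕ} {σ₀ θ₀ θ ν : ℝ} {Ω : Type*} [MeasurableSpace Ω] {P : Measure Ω}
  [IsProbabilityMeasure P] {T : Set (EuclideanSpace ℝ (Fin d))} {K R : T → T → ℝ}
  {X : T → Ω → ℝ} {x : ℕ → T} {N : ℕ}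

theorem le_integral_sigmaHatSq (hθ : 0 < θ) (hν : 0 < ν)
    (hK : ∀ s t, K s t = maternKernel ν θ₀ σ₀ (s : EuclideanSpace ℝ (Fin d)) t)
    (hR : ∀ s t, R s t = maternKernel ν θ 1 (s : EuclideanSpace ℝ (Fin d)) t)
    (hX : IsCenteredGaussianProcess X K P) (hx : Function.Injective x) (hN : 0 < N) {c : ℝ}
    (h : ∀ v : Fin N → ℝ, c * maternForm ν (fun i : Fin N => (x i : EuclideanSpace ℝ (Fin d))) v θ ≤
      maternForm ν (fun i : Fin N => (x i : EuclideanSpace ℝ (Fin d))) v θ₀) :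
    σ₀ ^ 2 * c ≤ ∫ ω, sigmaHatSq R X x N ω ∂P := by
  have hN' : (0 : ℝ) < N := by exact_mod_cast hN
  rw [integral_sigmaHatSq hX, le_div_iff₀ hN']
  have hps := posSemidef_sub_smul (isHermitian_kernelMatrix hK x N)
    (isHermitian_kernelMatrix hR x N) (a := 1) (b := σ₀ ^ 2 * c) fun v => by
      rw [dotProduct_kernelMatrix_mulVec hK, dotProduct_kernelMatrix_mulVec hR]
      nlinarith [mul_le_mul_of_nonneg_left (h v) (sq_nonneg σ₀)]
  rw [one_smul] at hps
  simpa using mul_card_le_sum_inv_mul (posDef_kernelMatrix hν hθ one_pos hR hx N) hps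

theorem integral_sigmaHatSq_le (hθ : 0 < θ) (hν : 0 < ν)
    (hK : ∀ s t, K s t = maternKernel ν θ₀ σ₀ (s : EuclideanSpace ℝ (Fin d)) t)
    (hR : ∀ s t, R s t = maternKernel ν θ 1 (s : EuclideanSpace ℝ (Fin d)) t)
    (hX : IsCenteredGaussianProcess X K P) (hx : Function.Injective x) (hN : 0 < N) {c : ℝ}
    (h : ∀ v : Fin N → ℝ, maternForm ν (fun i : Fin N => (x i : EuclideanSpace ℝ (Fin d))) v θ₀ ≤
      c * maternForm ν (fun i : Fin N => (x i : EuclideanSpace ℝ (Fin d))) v θ) :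
    ∫ ω, sigmaHatSq R X x N ω ∂P ≤ σ₀ ^ 2 * c := by
  have hN' : (0 : ℝ) < N := by exact_mod_cast hN
  rw [integral_sigmaHatSq hX, div_le_iff₀ hN']
  have hps := posSemidef_sub_smul (isHermitian_kernelMatrix hR x N)
    (isHermitian_kernelMatrix hK x N) (a := σ₀ ^ 2 * c) (b := 1) fun v => by
      rw [dotProduct_kernelMatrix_mulVec hK, dotProduct_kernelMatrix_mulVec hR]
      nlinarith [mul_le_mul_of_nonneg_left (h v) (sq_nonneg σ₀)]
  rw [one_smul] at hps
  simpa using sum_inv_mul_le_mul_card (posDef_kernelMatrix hν hθ one_pos hR hx N) hps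

end Bounds

end MaternScale

theorem mainTheorem3 {d : ℕ} {σ₀ θ₀ θ ν₀ : ℝ} (hσ₀ : 0 < σ₀) (hθ₀ : 0 < θ₀) (hθ : 0 < θ)
    (hν₀ : 0 < ν₀)
    {Ω : Type*} [MeasurableSpace Ω] (P : Measure Ω) [IsProbabilityMeasure P]
    (K R : MaternScale.unitCube d → MaternScale.unitCube d → ℝ)
    (hK : ∀ s t, K s t =
      MaternScale.maternKernel ν₀ θ₀ σ₀ (s : EuclideanSpace ℝ (Fin d)) (t : EuclideanSpace ℝ (Fin d)))
    (hR : ∀ s t, R s t =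
      MaternScale.maternKernel ν₀ θ 1 (s : EuclideanSpace ℝ (Fin d)) (t : EuclideanSpace ℝ (Fin d)))
    (X : MaternScale.unitCube d → Ω → ℝ) (hX : MaternScale.IsCenteredGaussianProcess X K P)
    (x : ℕ → MaternScale.unitCube d) (hx : Function.Injective x) (N : ℕ) (hN : 0 < N) :
    Integrable (MaternScale.sigmaHatSq R X x N) P ∧
    (θ ≤ θ₀ →
      σ₀ ^ 2 * (θ / θ₀) ^ d ≤ ∫ ω, MaternScale.sigmaHatSq R X x N ω ∂P ∧
      ∫ ω, MaternScale.sigmaHatSq R X x N ω ∂P ≤ σ₀ ^ 2 * (θ₀ / θ) ^ (2 * ν₀)) ∧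
    (θ₀ ≤ θ →
      σ₀ ^ 2 * (θ₀ / θ) ^ (2 * ν₀) ≤ ∫ ω, MaternScale.sigmaHatSq R X x N ω ∂P ∧
      ∫ ω, MaternScale.sigmaHatSq R X x N ω ∂P ≤ σ₀ ^ 2 * (θ / θ₀) ^ d) ∧
    (θ = θ₀ → ∫ ω, MaternScale.sigmaHatSq R X x N ω ∂P = σ₀ ^ 2) := by
  have hle : θ ≤ θ₀ →
      σ₀ ^ 2 * (θ / θ₀) ^ d ≤ ∫ ω, MaternScale.sigmaHatSq R X x N ω ∂P ∧
      ∫ ω, MaternScale.sigmaHatSq R X x N ω ∂P ≤ σ₀ ^ 2 * (θ₀ / θ) ^ (2 * ν₀) := by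
    intro h
    refine ⟨MaternScale.le_integral_sigmaHatSq hθ hν₀ hK hR hX hx hN fun v => ?_,
      MaternScale.integral_sigmaHatSq_le hθ hν₀ hK hR hX hx hN fun v =>
        MaternScale.maternForm_le_rpow_mul _ v hν₀ hθ h⟩
    simpa using MaternScale.pow_mul_maternForm_le
      (fun i : Fin N => (x i : EuclideanSpace ℝ (Fin d))) v hν₀ hθ h
  refine ⟨MaternScale.integrable_sigmaHatSq hX R x N, hle, fun h => ⟨?_, ?_⟩, fun h => ?_⟩
  · refine MaternScale.le_integral_sigmaHatSq hθ hν₀ hK hR hX hx hN fun v => ?_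
    -- For `θ₀ ≤ θ` the form comparisons apply with the ranges exchanged, so their constants must be
    -- inverted.
    rw [← inv_div, Real.inv_rpow (by positivity)]
    exact (inv_mul_le_iff₀ (by positivity)).2 (MaternScale.maternForm_le_rpow_mul _ v hν₀ hθ₀ h)
  · refine MaternScale.integral_sigmaHatSq_le hθ hν₀ hK hR hX hx hN fun v => ?_
    have := MaternScale.pow_mul_maternForm_le
      (fun i : Fin N => (x i : EuclideanSpace ℝ (Fin d))) v hν₀ hθ₀ h
    rw [finrank_euclideanSpace_fin, ← inv_div, inv_pow] at this
    exact (inv_mul_le_iff₀ (by positivity)).1 this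
  -- At equal ranges both constants are `1`, so the two bounds coincide.
  · obtain ⟨h1, h2⟩ := hle h.le
    rw [h, div_self hθ₀.ne'] at h1 h2
    simp only [one_pow, Real.one_rpow, mul_one] at h1 h2
    exact le_antisymm h2 h1
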